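/- Fix an infinite set $V$ of variables and a set $A$ of actions with $|A|\le|V|$. Let $\Sigma$ be a signature of function symbols $f$ with finite arities $ar(f)$, $|\Sigma|\le|V|$; $\mathbb T(\Sigma)$ and $T(\Sigma)$ denote the terms over $V$ and the closed terms. **Specifications.** Literals are expressions $t\xrightarrow{a}t'$ (positive) and $t\not\xrightarrow{a}$ (negative) with $t,t'\in\mathbb T(\Sigma)$, $a\in A$; these two deny each other. A rule $\frac{H}{\alpha}$ has a set $H$ of literals as premises and a literal $\alpha$ as conclusion; the left-hand side of $\alpha$ is the source, its right-hand side (if any) the target. A transition system specification (TSS) $P=(\Sigma,R)$ has a set $R$ of rules; it is standard if all conclusions are positive. $P\vdash\frac{H}{\alpha}$ means that there is a well-founded tree labelled by literals, with root $\alpha$, in which each node is labelled by an element of $H$ (a hypothesis) or follows from the set of labels of the nodes directly above it by a substitution instance of a rule in $R$. For a closed literal $\alpha$, $P\vdash_{ws}\alpha$ means that there is a well-founded tree labelled by closed literals, with root $\alpha$, such that for every node with label $\beta$, and $K$ the set of labels directly above it, either $\frac K\beta$ is a closed substitution instance of a rule in $R$, or $\beta$ is negative and for every set $N$ of negative closed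 literals with $P\vdash\frac N\gamma$ for some closed $\gamma$ denying $\beta$, a literal in $K$ denies one in $N$. $P$ need not be complete: it may be that for some closed $t$ and $a$ neither $P\vdash_{ws}t\not\xrightarrow{a}$ nor $P\vdash_{ws}t\xrightarrow{a}t'$ for any $t'$. **Ready trace preorder.** Ready trace observations are given by $\varphi::=\top\mid a\varphi'\mid\bigwedge_{i\in I}\widetilde{a_i}\wedge\bigwedge_{j\in J}b_j\top\wedge\varphi'$ with $\varphi'$ a ready trace observation, $a,a_i,b_j\in A$ and $I,J$ arbitrary index sets. For $p\in T(\Sigma)$ let $p\models\top$ always; $p\models a\varphi$ iff $P\vdash_{ws}p\xrightarrow{a}q$ and $q\models\varphi$ for some $q\in T(\Sigma)$; $p\models\widetilde a$ iff $P\vdash_{ws}p\not\xrightarrow{a}$; and $p\models\bigwedge_{i\in I}\varphi_i$ iff $p\models\varphi_i$ for all $i\in I$. The ready trace preorder induced by $P$ is: $p\sqsubseteq^P_{RT}q$ iff every ready trace observation satisfied by $p$ is satisfied by $q$. **Ready trace format.** An ntytt rule is a rule in which the right-hand sides of positive premises are variables, all distinct, not occurring in the source. It is an ntyxt rule if its source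 is a variable, and an ntyft rule if its source is $f(x_1,\dots,x_{ar(f)})$ with distinct variables $x_i$. A rule has no lookahead if no variable occurring in the right-hand side of a positive premise occurs in the left-hand side of a premise. Let $\Lambda$ be a predicate on the arguments $(f,i)$, $1\le i\le ar(f)$, of function symbols; arguments satisfying $\Lambda$ are liquid. An occurrence of a variable in a term is at a $\Lambda$-liquid position if every argument position on the path from the root of the term to that occurrence is liquid. A variable is $\Lambda$-floating in an ntytt rule if it is the right-hand side of a positive premise, or occurs exactly once in the source, at a $\Lambda$-liquid position. An occurrence of a variable is propagated if it is in the target, or in the left-hand side of a positive premise whose right-hand side occurs in the target. A standard TSS is in ready trace format if all its rules are ntyft or ntyxt rules without lookahead and, for some $\Lambda$, in each of its rules each $\Lambda$-floating variable has at most one propagated occurrence, which must be at a $\Lambda$-liquid position. **Theorem.** If a standard TSS $P=(\Sigma,R)$, complete or not, is in ready trace format, then $\sqsubseteq^P_{RT}$ is a precongruence: it is a preorder on $T(\Sigma)$ such that for all $f\in\Sigma$, if $p_i\sqsubseteq^P_{RT}q_i$ for $i=1,\dots,ar(f)$, then $f(p_1,\dots,p_{ar(f)})\sqsubseteq^P_{RT}f(q_1,\dots,q_{ar(f)})$.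 -/

import Mathlib

/-! Transition system specifications with negative premises, well-supported provability, the
ready trace preorder they induce, and the ready trace format.

A signature is the functional part of a first-order language `L` (relation symbols play no role);
`V` is the type of variables, `A` the type of actions, `L.Term V` the type of terms and
`L.Term Empty` the type of closed terms. -/

namespace SOS

universe uF uR uV uA

/-- Closed terms over the signature `L`. -/
abbrev ClosedTerm (L : FirstOrder.Language.{uF, uR}) := L.Term Empty

/-- Positive literals `t —a→ t'` and negative literals `t —a↛`. -/
inductive Literal (L : FirstOrder.Language.{uF, uR}) (V : Type uV) (A : Type uA) where
  | pos (t : L.Term V) (a : A) (t' : L.Term V) : Literal L V A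
  | neg (t : L.Term V) (a : A) : Literal L V A

namespace Literal

variable {L : FirstOrder.Language.{uF, uR}} {V : Type uV} {A : Type uA}

/-- The left-hand side of a literal. -/
def lhs : Literal L V A → L.Term V
  | pos t _ _ => t
  | neg t _ => t

/-- The right-hand side of a literal, if any. -/
def rhs : Literal L V A → Option (L.Term V)
  | pos _ _ t' => some t'
  | neg _ _ => none

def IsPos (l : Literal L V A) : Prop := ∃ t a t', l = pos t a t'

def IsNeg (l : Literal L V A) : Prop := ∃ t a, l = neg t a

/-- `t —a→ t'` and `t —a↛` deny each other. -/
def Denies : Literal L V A → Literal L V A → Prop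
  | pos t a _, neg s b => t = s ∧ a = b
  | neg t a, pos s b _ => t = s ∧ a = b
  | pos _ _ _, pos _ _ _ => False
  | neg _ _, neg _ _ => False

/-- Application of a substitution. A partial substitution is a total one that is the identity
outside its domain; a closed substitution is a function `V → ClosedTerm L`. -/
def subst {W : Type*} (σ : V → L.Term W) : Literal L V A → Literal L W A
  | pos t a t' => pos (t.subst σ) a (t'.subst σ)
  | neg t a => neg (t.subst σ) a

/-- A closed literal, seen as a literal over the variables `V`. -/
def ofClosed (V : Type uV) (l : Literal L Empty A) : Literal L V A := l.subst Empty.elim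

end Literal

/-- A transition rule: a set of premises and a conclusion. -/
structure Rule (L : FirstOrder.Language.{uF, uR}) (V : Type uV) (A : Type uA) where
  premises : Set (Literal L V A)
  conclusion : Literal L V A

/-- A transition system specification over the signature `L`: a set of transition rules. -/
structure TSS (L : FirstOrder.Language.{uF, uR}) (V : Type uV) (A : Type uA) where
  rules : Set (Rule L V A)

variable {L : FirstOrder.Language.{uF, uR}} {V : Type uV} {A : Type uA}

/-- A TSS is standard if all its rules have positive conclusions. -/
def TSS.IsStandard (P : TSS L V A) : Prop := ∀ r ∈ P.rules, r.conclusion.IsPos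

/-! ### Provability -/

/-- `Provable P H α`: there is a proof of the rule `H / α` from `P`, that is, a well-founded tree
of (possibly open) literals with root `α` in which every node either is a hypothesis
belonging to `H`, or follows from the nodes directly above it by a substitution instance of a rule
of `P`. -/
inductive Provable (P : TSS L V A) (H : Set (Literal L V A)) : Literal L V A → Prop
  | hyp {α : Literal L V A} (h : α ∈ H) : Provable P H α
  | rule {r : Rule L V A} (hr : r ∈ P.rules) (σ : V → L.Term V)
      (h : ∀ β ∈ r.premises, Provable P H (β.subst σ)) : Provable P H (r.conclusion.subst σ)

/-- `WSProvable P α`: there is a well-supported proof of the closed literal `α` from `P`, that is,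
a well-founded tree of closed literals with root `α` in which every node `β`, with `K` the set of
labels directly above it, either is inferred by a closed substitution instance of a rule, or is
negative and such that for every set `N` of negative closed literals from which a literal denying
`β` is provable, some literal of `K` denies one of `N`. -/
inductive WSProvable (P : TSS L V A) : Literal L Empty A → Prop
  | rule {r : Rule L V A} (hr : r ∈ P.rules) (σ : V → ClosedTerm L)
      (h : ∀ β ∈ r.premises, WSProvable P (β.subst σ)) : WSProvable P (r.conclusion.subst σ)
  | naf {β : Literal L Empty A} (K : Set (Literal L Empty A)) (hK : ∀ κ ∈ K, WSProvable P κ)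
      (hβ : β.IsNeg)
      (h : ∀ (N : Set (Literal L Empty A)) (γ : Literal L Empty A), (∀ ν ∈ N, ν.IsNeg) →
        γ.Denies β → Provable P (Literal.ofClosed V '' N) (γ.ofClosed V) →
        ∃ κ ∈ K, ∃ ν ∈ N, κ.Denies ν) : WSProvable P β

/-! ### Observations and the ready trace preorder -/

/-- Observations (modal formulas) without negation: `⊤`, `a φ`, `ã` and `⋀_{i ∈ I} φ_i`. -/
inductive Obs (A : Type uA) : Type (uA + 1)
  | top : Obs A
  | act (a : A) (φ : Obs A) : Obs A
  | cannot (a : A) : Obs A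
  | conj (I : Type uA) (φ : I → Obs A) : Obs A

/-- Binary conjunction. -/
def Obs.and (φ ψ : Obs A) : Obs A := .conj (ULift Bool) fun i => if i.down then φ else ψ

/-- The ready trace observations:
`φ ::= ⊤ | a φ' | ⋀_{i ∈ I} ã_i ∧ ⋀_{j ∈ J} b_j ⊤ ∧ φ'`. -/
inductive Obs.IsReadyTrace : Obs A → Prop
  | top : IsReadyTrace .top
  | act (a : A) {φ : Obs A} (h : IsReadyTrace φ) : IsReadyTrace (.act a φ)
  | ready (I J : Type uA) (a : I → A) (b : J → A) {φ : Obs A} (h : IsReadyTrace φ) :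
      IsReadyTrace ((Obs.conj I fun i => .cannot (a i)).and
        ((Obs.conj J fun j => .act (b j) .top).and φ))

/-- The satisfaction relation between closed terms and observations induced by `P`, with respect
to the three-valued transition relation of well-supported provable literals. -/
def Sat (P : TSS L V A) : ClosedTerm L → Obs A → Prop
  | _, .top => True
  | p, .act a φ => ∃ q, WSProvable P (.pos p a q) ∧ Sat P q φ
  | p, .cannot a => WSProvable P (.neg p a)
  | p, .conj _ φ => ∀ i, Sat P p (φ i)

/-- The set of ready trace observations of a closed term. -/
def readyTraceObs (P : TSS L V A) (p : ClosedTerm L) : Set (Obs A) :=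
  {φ | φ.IsReadyTrace ∧ Sat P p φ}

/-- The ready trace preorder induced by `P`. -/
def ReadyTraceLE (P : TSS L V A) (p q : ClosedTerm L) : Prop :=
  readyTraceObs P p ⊆ readyTraceObs P q

/-- A precongruence: a preorder on closed terms that is preserved by all function symbols. -/
def IsPrecongruence (R : ClosedTerm L → ClosedTerm L → Prop) : Prop :=
  (∀ p, R p p) ∧ (∀ p q r, R p q → R q r → R p r) ∧
  ∀ (n : ℕ) (f : L.Functions n) (p q : Fin n → ClosedTerm L),
    (∀ i, R (p i) (q i)) → R (.func f p) (.func f q)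

/-! ### Occurrences of variables -/

/-- The type of occurrences of the variable `x` in a term. -/
def Occ (x : V) : L.Term V → Type
  | .var y => PLift (y = x)
  | .func _ ts => Σ i, Occ x (ts i)

/-- The variable `x` occurs in the term `t`. -/
def OccursIn (x : V) (t : L.Term V) : Prop := Nonempty (Occ x t)

/-- A predicate `Λ` on the arguments of function symbols: argument `i` of `f` is liquid if `Λ f i`
holds, and frozen otherwise. -/
abbrev ArgPred (L : FirstOrder.Language.{uF, uR}) := ∀ ⦃n : ℕ⦄, L.Functions n → Fin n → Prop

/-- The occurrence is at a `Λ`-liquid position in the term. -/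
def Occ.Liquid (Λ : ArgPred L) {x : V} : {t : L.Term V} → Occ x t → Prop
  | .var _, _ => True
  | .func f _, ⟨i, o⟩ => Λ f i ∧ Occ.Liquid Λ o

/-! ### Rule formats -/

namespace Rule

/-- The source of a rule: the left-hand side of its conclusion. -/
def source (r : Rule L V A) : L.Term V := r.conclusion.lhs

/-- The target of a rule, if any: the right-hand side of its conclusion. -/
def target (r : Rule L V A) : Option (L.Term V) := r.conclusion.rhs

/-- The right-hand sides of positive premises are variables, all distinct, not occurring in the
source. -/
structure IsNtytt (r : Rule L V A) : Prop where
  rhs_var : ∀ l ∈ r.premises, ∀ t ∈ l.rhs, ∃ y : V, t = .var y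
  rhs_distinct : ∀ l ∈ r.premises, ∀ l' ∈ r.premises, ∀ t ∈ l.rhs, t ∈ l'.rhs → l = l'
  rhs_not_source : ∀ l ∈ r.premises, ∀ y : V, .var y ∈ l.rhs → ¬ OccursIn y r.source

/-- An ntytt rule whose source is a variable. -/
def IsNtyxt (r : Rule L V A) : Prop := r.IsNtytt ∧ ∃ x : V, r.source = .var x

/-- An ntytt rule whose source is `f(x₁, …, xₙ)` with distinct variables `x₁, …, xₙ`. -/
def IsNtyft (r : Rule L V A) : Prop :=
  r.IsNtytt ∧ ∃ (n : ℕ) (f : L.Functions n) (x : Fin n → V),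
    Function.Injective x ∧ r.source = .func f fun i => .var (x i)

/-- The variables occurring in right-hand sides of positive premises do not occur in left-hand
sides of premises. -/
def NoLookahead (r : Rule L V A) : Prop :=
  ∀ l ∈ r.premises, ∀ t ∈ l.rhs, ∀ y : V, OccursIn y t → ∀ l' ∈ r.premises, ¬ OccursIn y l'.lhs

/-- The variable `x` is the right-hand side of a positive premise, or occurs exactly once in the
source, at a `Λ`-liquid position. -/
def Floating (Λ : ArgPred L) (r : Rule L V A) (x : V) : Prop :=
  (∃ l ∈ r.premises, .var x ∈ l.rhs) ∨
    ∃ o : Occ x r.source, (∀ o' : Occ x r.source, o' = o) ∧ o.Liquid Λ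

/-- The propagated occurrences of `x` in an ntytt rule: those in the target, and those in the
left-hand side of a positive premise whose right-hand side occurs in the target. -/
inductive PropagatedOcc (r : Rule L V A) (x : V) : Type (max uF uV uA)
  | inTarget (u : L.Term V) (hu : u ∈ r.target) (o : Occ x u)
  | inPremise (t : L.Term V) (a : A) (y : V) (hl : Literal.pos t a (.var y) ∈ r.premises)
      (u : L.Term V) (hu : u ∈ r.target) (hy : OccursIn y u) (o : Occ x t)

/-- A propagated occurrence is at a `Λ`-liquid position. -/
def PropagatedOcc.Liquid (Λ : ArgPred L) {r : Rule L V A} {x : V} : r.PropagatedOcc x → Prop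
  | .inTarget _ _ o => o.Liquid Λ
  | .inPremise _ _ _ _ _ _ _ o => o.Liquid Λ

/-- The rule has no lookahead, and each `Λ`-floating variable has at most one propagated
occurrence, which must be at a `Λ`-liquid position. -/
def ReadyTraceSafe (Λ : ArgPred L) (r : Rule L V A) : Prop :=
  r.NoLookahead ∧
    ∀ x : V, r.Floating Λ x →
      (∀ o o' : r.PropagatedOcc x, o = o') ∧ ∀ o : r.PropagatedOcc x, o.Liquid Λ

end Rule

/-- The TSS is in ntyft/ntyxt format and its rules are `Λ`-ready trace safe for some `Λ`. -/
def TSS.InReadyTraceFormat (P : TSS L V A) : Prop :=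
  (∀ r ∈ P.rules, r.IsNtyft ∨ r.IsNtyxt) ∧
    ∃ Λ : ArgPred L, ∀ r ∈ P.rules, r.ReadyTraceSafe Λ

end SOS

/-! Ready trace observations of `t.subst ρ`, where `t` is a term and `ρ` a closed substitution, are
decomposed into ready trace observations of the closed terms `ρ x` (`exists_decomposition`). For
`t = f(x₁, …, xₙ)` this is the congruence property: the observations obtained from an observation of
`f(p₁, …, pₙ)` hold for the `pᵢ`, hence for the `qᵢ`, and so the original one holds for
`f(q₁, …, qₙ)`.

*Transitions and refusals.* By induction on well-supported proofs (`WSProvable.decomposable`), a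
transition `t.subst ρ —a→ q` is an instance of something like a rule with source `t`: it depends
on the actions that the `ρ x` can do and refuse, and on finitely or infinitely many transitions
`ρ x —c→ q'`, whose results `q'` are, along with the `ρ x`, put for the variables of a target `u`
to give `q` (`Ruloid`). As there is no lookahead, left-hand sides of premises are again of the form
`p.subst ρ`, with the same `ρ`, so that only initial actions of the `ρ x` matter. A refusal
`t.subst ρ —a↛` depends only on the actions the `ρ x` can do and refuse. Indeed, suppose that `ρ'`
shares these with `ρ` while `t.subst ρ' —a↛` has no well-supported proof. Then `t.subst ρ' —a→` is
provable from negative hypotheses that are not refuted. The same rules prove `t.subst ρ —a→`: its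
negative hypotheses are not refuted by the literals supporting `t.subst ρ —a↛` either, since such a
refutation is covered by the induction hypothesis and carries over to `ρ'`
(`ClosedProvable.exists_of_readyLE`).

*Linearity.* A ready trace observation does not branch, so a decomposition in which `x` is passed to
several places of the target gives a conjunction of several observations of `ρ x`. Such conjunctions
are preserved by the preorder, but they may not occur behind an action. Hence the
decomposition attaches sets of observations to variables, which are singletons for the variables
occurring at most once, at a liquid position (`LiquidOnce`). The results `q'` of transitions are
put for variables of the latter kind, and ready trace safety is what makes this kind persist from
the source to the target (`Rule.ReadyTraceSafe.liquidOnce_target`). -/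

namespace SOS

universe uF uR uV uA uW uX

variable {L : FirstOrder.Language.{uF, uR}} {V : Type uV} {A : Type uA}
variable {W : Type uW} {X : Type uX}

/-! ### Substitutions -/

theorem subst_subst (t : L.Term V) (σ : V → L.Term W) (τ : W → L.Term X) :
    (t.subst σ).subst τ = t.subst fun v => (σ v).subst τ := by
  induction t with
  | var v => rfl
  | func f ts ih => simp only [FirstOrder.Language.Term.subst, ih]

theorem subst_var (t : L.Term V) : t.subst FirstOrder.Language.Term.var = t := by
  induction t with
  | var v => rfl
  | func f ts ih => simp only [FirstOrder.Language.Term.subst, ih]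

/-- A closed term, seen as a term over the variables `W`. -/
def embed (W : Type uW) (p : ClosedTerm L) : L.Term W := p.subst Empty.elim

theorem embed_subst (p : ClosedTerm L) (ρ : W → L.Term X) :
    (embed W p).subst ρ = embed X p := by
  rw [embed, subst_subst]
  congr 1
  funext v
  exact v.elim

theorem embed_self (p : ClosedTerm L) : embed Empty p = p := by
  conv_rhs => rw [← subst_var p]
  rw [embed]
  congr 1
  funext v
  exact v.elim

theorem not_occursIn_embed (p : ClosedTerm L) (x : W) : ¬ OccursIn x (embed W p) := by
  rintro ⟨o⟩
  induction p with
  | var v => exact v.elim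
  | func f ts ih => exact ih o.1 o.2

theorem subst_congr {t : L.Term V} {σ τ : V → L.Term W}
    (h : ∀ v, OccursIn v t → σ v = τ v) : t.subst σ = t.subst τ := by
  induction t with
  | var v => exact h v ⟨⟨rfl⟩⟩
  | func f ts ih =>
    simp only [FirstOrder.Language.Term.subst]
    congr 1
    funext i
    exact ih i fun v ⟨o⟩ => h v ⟨⟨i, o⟩⟩

/-! ### Occurrences of variables in instances of terms -/

/-- The occurrence of `x` in `t.subst σ` that lies, within the copy of `σ v` put in place of the
occurrence `o` of `v` in `t`, at `o'`. -/
def Occ.comp {v : V} {x : W} {σ : V → L.Term W} :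
    {t : L.Term V} → Occ v t → Occ x (σ v) → Occ x (t.subst σ)
  | .var _, o, o' => cast (congrArg (fun w => Occ x (σ w)) o.down.symm) o'
  | .func _ _, ⟨i, o⟩, o' => ⟨i, Occ.comp o o'⟩

theorem Occ.exists_comp {x : W} {σ : V → L.Term W} {t : L.Term V} (o : Occ x (t.subst σ)) :
    ∃ (v : V) (o₁ : Occ v t) (o₂ : Occ x (σ v)), o = o₁.comp o₂ := by
  induction t with
  | var v => exact ⟨v, ⟨rfl⟩, o, rfl⟩
  | func f ts ih =>
    obtain ⟨i, o⟩ := o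
    obtain ⟨v, o₁, o₂, rfl⟩ := ih i o
    exact ⟨v, ⟨i, o₁⟩, o₂, rfl⟩

theorem Occ.comp_inj {v w : V} {x : W} {σ : V → L.Term W} {t : L.Term V} {o₁ : Occ v t}
    {o₂ : Occ x (σ v)} {p₁ : Occ w t} {p₂ : Occ x (σ w)} (h : o₁.comp o₂ = p₁.comp p₂) :
    (⟨v, o₁, o₂⟩ : Σ v, Occ v t × Occ x (σ v)) = ⟨w, p₁, p₂⟩ := by
  induction t with
  | var u =>
    obtain ⟨rfl⟩ := o₁
    obtain ⟨rfl⟩ := p₁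
    have : o₂ = p₂ := h
    rw [this]
  | func f ts ih =>
    obtain ⟨i, o₁⟩ := o₁
    obtain ⟨j, p₁⟩ := p₁
    have hij : i = j := congrArg Sigma.fst h
    subst hij
    have h' : o₁.comp o₂ = p₁.comp p₂ := eq_of_heq (Sigma.mk.inj h).2
    cases ih i h'
    rfl

theorem Occ.liquid_comp {Λ : ArgPred L} {v : V} {x : W} {σ : V → L.Term W} {t : L.Term V}
    {o₁ : Occ v t} {o₂ : Occ x (σ v)} :
    (o₁.comp o₂).Liquid Λ ↔ o₁.Liquid Λ ∧ o₂.Liquid Λ := by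
  induction t with
  | var u =>
    obtain ⟨rfl⟩ := o₁
    exact ⟨fun h => ⟨trivial, h⟩, And.right⟩
  | func f ts ih =>
    obtain ⟨i, o₁⟩ := o₁
    exact (and_congr_right fun _ => ih i).trans and_assoc.symm

/-- The variable `x` has at most one occurrence in `t`, which must be at a `Λ`-liquid position. -/
def LiquidOnce (Λ : ArgPred L) (t : L.Term W) (x : W) : Prop :=
  (∀ o o' : Occ x t, o = o') ∧ ∀ o : Occ x t, o.Liquid Λ

theorem liquidOnce_var (Λ : ArgPred L) (x y : W) :
    LiquidOnce Λ (.var y : L.Term W) x :=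
  ⟨fun ⟨_⟩ ⟨_⟩ => rfl, fun _ => trivial⟩

/-- If `m v` occurs at most once, liquidly, after a renaming `m` of variables, not necessarily
injective, then so does `v` before it, and no other variable of `t` is identified with `v`. -/
theorem LiquidOnce.of_rename {Λ : ArgPred L} {t : L.Term V} {m : V → W} {v : V}
    (h : LiquidOnce Λ (t.subst fun v => .var (m v)) (m v)) :
    LiquidOnce Λ t v ∧ ∀ w, OccursIn v t → OccursIn w t → m w = m v → w = v := by
  let e (w : V) (hw : m w = m v) (o : Occ w t) : Occ (m v) (t.subst fun v => .var (m v)) :=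
    o.comp (σ := fun v => .var (m v)) ⟨hw⟩
  refine ⟨⟨fun o o' => ?_, fun o => (Occ.liquid_comp.1 (h.2 (e v rfl o))).1⟩, ?_⟩
  · cases Occ.comp_inj (h.1 (e v rfl o) (e v rfl o'))
    rfl
  · rintro w ⟨o⟩ ⟨o'⟩ hw
    exact congrArg Sigma.fst (Occ.comp_inj (h.1 (e w hw o') (e v rfl o)))

theorem LiquidOnce.subst {Λ : ArgPred L} {t : L.Term V} {σ : V → L.Term W} {x : W}
    (h : ∀ v, OccursIn v t → OccursIn x (σ v) → LiquidOnce Λ t v ∧ LiquidOnce Λ (σ v) x)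
    (huniq : ∀ v w, OccursIn v t → OccursIn x (σ v) → OccursIn w t → OccursIn x (σ w) → v = w) :
    LiquidOnce Λ (t.subst σ) x := by
  refine ⟨fun o o' => ?_, fun o => ?_⟩
  · obtain ⟨v, o₁, o₂, rfl⟩ := o.exists_comp
    obtain ⟨w, p₁, p₂, rfl⟩ := o'.exists_comp
    obtain rfl := huniq v w ⟨o₁⟩ ⟨o₂⟩ ⟨p₁⟩ ⟨p₂⟩
    obtain ⟨h₁, h₂⟩ := h v ⟨o₁⟩ ⟨o₂⟩
    rw [h₁.1 o₁ p₁, h₂.1 o₂ p₂]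
  · obtain ⟨v, o₁, o₂, rfl⟩ := o.exists_comp
    obtain ⟨h₁, h₂⟩ := h v ⟨o₁⟩ ⟨o₂⟩
    exact Occ.liquid_comp.2 ⟨h₁.2 _, h₂.2 _⟩

theorem occursIn_subst {t : L.Term V} {σ : V → L.Term W} {x : W} :
    OccursIn x (t.subst σ) ↔ ∃ v, OccursIn v t ∧ OccursIn x (σ v) := by
  constructor
  · rintro ⟨o⟩
    obtain ⟨v, o₁, o₂, -⟩ := o.exists_comp
    exact ⟨v, ⟨o₁⟩, ⟨o₂⟩⟩
  · rintro ⟨v, ⟨o₁⟩, ⟨o₂⟩⟩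
    exact ⟨o₁.comp o₂⟩

/-! ### Ntyft and ntyxt rules, and the single way into the target -/

/-- The right-hand sides of the positive premises of a rule. -/
def Rule.PremiseRhs (r : Rule L V A) (y : V) : Prop :=
  ∃ s c, Literal.pos s c (.var y) ∈ r.premises

theorem Rule.IsNtytt.not_occursIn_source {r : Rule L V A} (hr : r.IsNtytt) {y : V}
    (hy : r.PremiseRhs y) : ¬ OccursIn y r.source := by
  obtain ⟨s, c, h⟩ := hy
  exact hr.rhs_not_source _ h y rfl

theorem Rule.isNtytt_of_format {r : Rule L V A} (hr : r.IsNtyft ∨ r.IsNtyxt) : r.IsNtytt :=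
  hr.elim And.left And.left

theorem Rule.occ_source_unique {r : Rule L V A} (hr : r.IsNtyft ∨ r.IsNtyxt) (v : V)
    (o o' : Occ v r.source) : o = o' := by
  have key : ∀ s : L.Term V, s = r.source → ∀ o o' : Occ v s, o = o' := by
    intro s hs o o'
    rcases hr with ⟨-, n, f, x, hx, h⟩ | ⟨-, x, h⟩
    · obtain rfl := hs.trans h
      obtain ⟨i, ⟨hi⟩⟩ := o
      obtain ⟨j, ⟨hj⟩⟩ := o'
      obtain rfl := hx (hi.trans hj.symm)
      rfl
    · obtain rfl := hs.trans h
      obtain ⟨hi⟩ := o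
      obtain ⟨hj⟩ := o'
      rfl
  exact key _ rfl o o'

/-- If a closed instance of a rule has a closed instance `t.subst ρ` of a term `t`, not a variable,
as its source, then the closed substitution factors through `ρ` in such a way that the instance of
the source becomes `t`. Variables outside the source stay closed. -/
theorem Rule.exists_match {r : Rule L V A} (hr : r.IsNtyft ∨ r.IsNtyxt) {σ : V → ClosedTerm L}
    {ρ : W → ClosedTerm L} {n : ℕ} {f : L.Functions n} {ts : Fin n → L.Term W}
    (h : r.source.subst σ = (FirstOrder.Language.Term.func f ts).subst ρ) :
    ∃ σ₀ : V → L.Term W, r.source.subst σ₀ = .func f ts ∧ (∀ v, (σ₀ v).subst ρ = σ v) ∧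
      ∀ v x, OccursIn x (σ₀ v) → OccursIn v r.source := by
  classical
  rcases hr with ⟨-, m, g, x, hx, hs⟩ | ⟨-, x, hs⟩
  · rw [hs] at h ⊢
    simp only [FirstOrder.Language.Term.subst] at h
    injection h with h₁ h₂ h₃
    subst h₁
    obtain rfl := eq_of_heq h₂
    have h₃ := congrFun (eq_of_heq h₃)
    refine ⟨fun v => if hv : ∃ i, x i = v then ts hv.choose else embed W (σ v), ?_, ?_, ?_⟩
    · simp only [FirstOrder.Language.Term.subst]
      congr 1
      funext i
      have hv : ∃ j, x j = x i := ⟨i, rfl⟩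
      rw [dif_pos hv, hx hv.choose_spec]
    · intro v
      dsimp only
      split_ifs with hv
      · rw [← h₃, hv.choose_spec]
      · rw [embed_subst, embed_self]
    · intro v y hy
      dsimp only at hy
      split_ifs at hy with hv
      · exact ⟨⟨hv.choose, ⟨hv.choose_spec⟩⟩⟩
      · exact (not_occursIn_embed _ _ hy).elim
  · rw [hs] at h ⊢
    refine ⟨fun v => if v = x then .func f ts else embed W (σ v), ?_, ?_, ?_⟩
    · exact if_pos rfl
    · intro v
      dsimp only
      split_ifs with hv
      · rw [hv]
        exact h.symm
      · rw [embed_subst, embed_self]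
    · intro v y hy
      dsimp only at hy
      split_ifs at hy with hv
      · exact ⟨⟨hv.symm⟩⟩
      · exact (not_occursIn_embed _ _ hy).elim

/-- The variable of the target that a propagated occurrence of `x` leads to: `x` itself for an
occurrence in the target, and the right-hand side of the premise for one in a premise. -/
def Rule.PropagatedOcc.endpoint {r : Rule L V A} {x : V} : r.PropagatedOcc x → V
  | .inTarget _ _ _ => x
  | .inPremise _ _ y _ _ _ _ _ => y

/-- Let `σ₁` agree with `σ₀`, except that it replaces the right-hand side of each positive premise
by a term that preserves single liquid occurrences of variables in the left-hand side. Then the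
instance of the target preserves those in the source. This is what ready trace safety is for: the
one occurrence of `x` in the source lies in the image of a floating variable, which has a single
propagated occurrence, so that there is a single way for `x` to get into the target. -/
theorem Rule.ReadyTraceSafe.liquidOnce_target {Λ : ArgPred L} {r : Rule L V A}
    (hsafe : r.ReadyTraceSafe Λ) (hr : r.IsNtyft ∨ r.IsNtyxt) {u : L.Term V} (hu : u ∈ r.target)
    {σ₀ σ₁ : V → L.Term W} (hsrc : ∀ v x, OccursIn x (σ₀ v) → OccursIn v r.source)
    (h₀ : ∀ v, ¬ r.PremiseRhs v → σ₁ v = σ₀ v)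
    (hocc : ∀ s c y, Literal.pos s c (.var y) ∈ r.premises → ∀ x, OccursIn x (σ₁ y) →
      OccursIn x (s.subst σ₀))
    (h₁ : ∀ s c y, Literal.pos s c (.var y) ∈ r.premises → ∀ x, LiquidOnce Λ (s.subst σ₀) x →
      LiquidOnce Λ (σ₁ y) x)
    {x : W} (hx : LiquidOnce Λ (r.source.subst σ₀) x) : LiquidOnce Λ (u.subst σ₁) x := by
  -- `x` is brought in by a single variable of the source, and that variable is floating.
  have floating : ∀ v, OccursIn x (σ₀ v) → r.Floating Λ v := by
    rintro v ⟨o⟩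
    obtain ⟨os⟩ := hsrc v x ⟨o⟩
    exact .inr ⟨os, fun o' => occ_source_unique hr v _ _, (Occ.liquid_comp.1 (hx.2 (os.comp o))).1⟩
  have uniq : ∀ v w, OccursIn x (σ₀ v) → OccursIn x (σ₀ w) → v = w := by
    rintro v w ⟨o⟩ ⟨p⟩
    obtain ⟨os⟩ := hsrc v x ⟨o⟩
    obtain ⟨ps⟩ := hsrc w x ⟨p⟩
    exact congrArg Sigma.fst (Occ.comp_inj (hx.1 (os.comp o) (ps.comp p)))
  have once₀ : ∀ v, LiquidOnce Λ (σ₀ v) x := by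
    refine fun v => ⟨fun o o' => ?_, fun o => ?_⟩
    · obtain ⟨os⟩ := hsrc v x ⟨o⟩
      cases Occ.comp_inj (hx.1 (os.comp o) (os.comp o'))
      rfl
    · obtain ⟨os⟩ := hsrc v x ⟨o⟩
      exact (Occ.liquid_comp.1 (hx.2 (os.comp o))).2
  have once_target : ∀ v, r.Floating Λ v → LiquidOnce Λ u v := by
    refine fun v hv => ⟨fun o o' => ?_, fun o => (hsafe.2 v hv).2 (.inTarget u hu o)⟩
    cases (hsafe.2 v hv).1 (.inTarget u hu o) (.inTarget u hu o')
    rfl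
  have once_premise : ∀ s c y, Literal.pos s c (.var y) ∈ r.premises → OccursIn y u →
      LiquidOnce Λ (s.subst σ₀) x := by
    intro s c y hl hy
    refine .subst (fun v _ hv => ⟨⟨fun o o' => ?_, fun o => ?_⟩, once₀ v⟩)
      fun v w _ hv _ hw => uniq v w hv hw
    · cases (hsafe.2 v (floating v hv)).1 (.inPremise s c y hl u hu hy o)
        (.inPremise s c y hl u hu hy o')
      rfl
    · exact (hsafe.2 v (floating v hv)).2 (.inPremise s c y hl u hu hy o)
  have origin : ∀ v, OccursIn v u → OccursIn x (σ₁ v) →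
      ∃ w, OccursIn x (σ₀ w) ∧ ∃ o : r.PropagatedOcc w, o.endpoint = v := by
    rintro v ⟨o⟩ hv
    by_cases hv' : r.PremiseRhs v
    · obtain ⟨s, c, hl⟩ := hv'
      obtain ⟨w, ⟨ow⟩, hw⟩ := occursIn_subst.1 (hocc s c v hl x hv)
      exact ⟨w, hw, .inPremise s c v hl u hu ⟨o⟩ ow, rfl⟩
    · rw [h₀ v hv'] at hv
      exact ⟨v, hv, .inTarget u hu o, rfl⟩
  refine .subst (fun v hv hv' => ?_) fun v w hv hv' hw hw' => ?_
  · by_cases hvy : r.PremiseRhs v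
    · obtain ⟨s, c, hl⟩ := hvy
      exact ⟨once_target v (.inl ⟨_, hl, rfl⟩), h₁ s c v hl x (once_premise s c v hl hv)⟩
    · rw [h₀ v hvy] at hv' ⊢
      exact ⟨once_target v (floating v hv'), once₀ v⟩
  · obtain ⟨v', hv₁, o, rfl⟩ := origin v hv hv'
    obtain ⟨w', hw₁, o', rfl⟩ := origin w hw hw'
    obtain rfl := uniq v' w' hv₁ hw₁
    rw [(hsafe.2 v' (floating v' hv₁)).1 o o']

theorem Rule.NoLookahead.not_premiseRhs {r : Rule L V A} (hr : r.NoLookahead) {l : Literal L V A}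
    (hl : l ∈ r.premises) (v : V) (hv : OccursIn v l.lhs) : ¬ r.PremiseRhs v := by
  rintro ⟨p, c, hp⟩
  exact hr _ hp _ rfl v ⟨⟨rfl⟩⟩ l hl hv

/-! ### Provability by closed instances of rules -/

theorem Literal.subst_subst {U : Type*} {X : Type*} (l : Literal L V A) (σ : V → L.Term U)
    (τ : U → L.Term X) : (l.subst σ).subst τ = l.subst fun v => (σ v).subst τ := by
  cases l <;> simp only [Literal.subst, SOS.subst_subst]

theorem Literal.ofClosed_subst (l : Literal L Empty A) (σ : V → ClosedTerm L) :
    (l.ofClosed V).subst σ = l := by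
  have key (p : ClosedTerm L) : (embed V p).subst σ = p := by rw [embed_subst, embed_self]
  cases l with
  | pos p a q => exact congrArg₂ (Literal.pos · a ·) (key p) (key q)
  | neg p a => exact congrArg (Literal.neg · a) (key p)

/-- Provability from a set of closed literals by closed instances of rules only. -/
inductive ClosedProvable (P : TSS L V A) (N : Set (Literal L Empty A)) : Literal L Empty A → Prop
  | hyp {α : Literal L Empty A} (h : α ∈ N) : ClosedProvable P N α
  | rule {r : Rule L V A} (hr : r ∈ P.rules) (σ : V → ClosedTerm L)
      (h : ∀ β ∈ r.premises, ClosedProvable P N (β.subst σ)) :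
      ClosedProvable P N (r.conclusion.subst σ)

theorem Provable.closed {P : TSS L V A} {H : Set (Literal L V A)} {α : Literal L V A}
    (h : Provable P H α) (σ : V → ClosedTerm L) {N : Set (Literal L Empty A)}
    (hN : ∀ β ∈ H, β.subst σ ∈ N) : ClosedProvable P N (α.subst σ) := by
  induction h with
  | hyp h => exact .hyp (hN _ h)
  | rule hr τ _ ih =>
    rw [Literal.subst_subst]
    refine .rule hr _ fun β hβ => ?_
    rw [← Literal.subst_subst]
    exact ih β hβ

theorem ClosedProvable.provable {P : TSS L V A} {N : Set (Literal L Empty A)}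
    {α : Literal L Empty A} (h : ClosedProvable P N α) :
    Provable P (Literal.ofClosed V '' N) (α.ofClosed V) := by
  induction h with
  | hyp h => exact .hyp ⟨_, h, rfl⟩
  | rule hr σ _ ih =>
    rw [Literal.ofClosed, Literal.subst_subst]
    refine .rule hr _ fun β hβ => ?_
    rw [← Literal.subst_subst]
    exact ih β hβ

/-- A proof using open terms yields a proof using closed ones, as there is a closed term to
replace the variables by. -/
theorem provable_ofClosed_iff {P : TSS L V A} {N : Set (Literal L Empty A)}
    {α : Literal L Empty A} :
    Provable P (Literal.ofClosed V '' N) (α.ofClosed V) ↔ ClosedProvable P N α := by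
  refine ⟨fun h => ?_, ClosedProvable.provable⟩
  rw [← α.ofClosed_subst fun _ => α.lhs]
  refine h.closed _ ?_
  rintro _ ⟨ν, hν, rfl⟩
  rwa [Literal.ofClosed_subst]

/-- In a standard TSS a negative literal can only be proved as a hypothesis. -/
theorem ClosedProvable.neg_mem {P : TSS L V A} (hstd : P.IsStandard)
    {N : Set (Literal L Empty A)} {p : ClosedTerm L} {a : A}
    (h : ClosedProvable P N (.neg p a)) : .neg p a ∈ N := by
  generalize hl : Literal.neg p a = l at h
  cases h with
  | hyp h => exact h
  | rule hr σ _ =>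
    obtain ⟨s, b, t, hc⟩ := hstd _ hr
    rw [hc] at hl
    cases hl

/-- If the refusal of `a` by `p` has no well-supported proof, then `p` can be proved to do `a` from
negative hypotheses none of which is refuted by a well-supported proof. -/
theorem exists_closedProvable_of_not_wsProvable_neg {P : TSS L V A} {p : ClosedTerm L} {a : A}
    (h : ¬ WSProvable P (.neg p a)) :
    ∃ (N : Set (Literal L Empty A)) (q : ClosedTerm L), ClosedProvable P N (.pos p a q) ∧
      (∀ ν ∈ N, ν.IsNeg) ∧ ∀ κ, WSProvable P κ → ∀ ν ∈ N, ¬ κ.Denies ν := by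
  by_contra hcon
  refine h (.naf {κ | WSProvable P κ} (fun _ h => h) ⟨p, a, rfl⟩ fun N γ hN hγ hP => ?_)
  by_contra hK
  cases γ with
  | neg s b => exact hγ
  | pos s b q =>
    obtain ⟨rfl, rfl⟩ := hγ
    exact hcon ⟨N, q, provable_ofClosed_iff.1 hP, hN, fun κ hκ ν hν hd => hK ⟨κ, hκ, ν, hν, hd⟩⟩

/-! ### Ready information and the decomposition of literals -/

section

variable {W : Type uV}

/-- Each closed term `ρ' x` can and cannot do what `ρ x` can and cannot do, as far as its initial
actions are concerned. Neither follows from the other, since the TSS may be incomplete. -/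
def ReadyLE (P : TSS L V A) (ρ ρ' : W → ClosedTerm L) : Prop :=
  ∀ x a, (WSProvable P (.neg (ρ x) a) → WSProvable P (.neg (ρ' x) a)) ∧
    ((∃ q, WSProvable P (.pos (ρ x) a q)) → ∃ q, WSProvable P (.pos (ρ' x) a q))

/-- A decomposition of the transition `t.subst ρ —a→ q` into transitions of the closed terms `ρ x`:
a semantic substitute for an open rule with source `t`, premises `src y —act y→ y` for `y : Y` and
target `u`, of which it is an instance. Any `ρ'` that has the ready information of `ρ` may be
used instead of `ρ`, so that premises about initial actions only, in particular the negative ones,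
are left implicit. -/
structure Ruloid (P : TSS L V A) (Λ : ArgPred L) (ρ : W → ClosedTerm L) (t : L.Term W) (a : A)
    (q : ClosedTerm L) where
  Y : Type uV
  u : L.Term (W ⊕ Y)
  src : Y → W
  act : Y → A
  τ : Y → ClosedTerm L
  ws : ∀ y, WSProvable P (.pos (ρ (src y)) (act y) (τ y))
  subst_eq : u.subst (Sum.elim ρ τ) = q
  sound : ∀ ρ' τ', ReadyLE P ρ ρ' → (∀ y, WSProvable P (.pos (ρ' (src y)) (act y) (τ' y))) →
    WSProvable P (.pos (t.subst ρ') a (u.subst (Sum.elim ρ' τ')))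
  liquidOnce_inr : ∀ y, LiquidOnce Λ u (.inr y)
  /-- Variables of the target, with `y` counted as `src y`, occur in the source. -/
  occursIn : ∀ x, OccursIn x (u.subst fun z => .var (Sum.elim id src z)) → OccursIn x t
  /-- Single liquid occurrences are preserved, with `y` counted as `src y`. -/
  liquidOnce : ∀ x, LiquidOnce Λ t x →
    LiquidOnce Λ (u.subst fun z => .var (Sum.elim id src z)) x

theorem Ruloid.exists_wsProvable {P : TSS L V A} {Λ : ArgPred L} {ρ : W → ClosedTerm L}
    {t : L.Term W} {a : A} {q : ClosedTerm L} (R : Ruloid P Λ ρ t a q) {ρ' : W → ClosedTerm L}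
    (h : ReadyLE P ρ ρ') : ∃ q', WSProvable P (.pos (t.subst ρ') a q') := by
  have (y : R.Y) : ∃ q, WSProvable P (.pos (ρ' (R.src y)) (R.act y) q) :=
    (h _ _).2 ⟨_, R.ws y⟩
  choose τ' hτ' using this
  exact ⟨_, R.sound ρ' τ' h hτ'⟩

/-- A transition of an instance `ρ x` of a variable is its own decomposition. -/
def Ruloid.ofVar {P : TSS L V A} (Λ : ArgPred L) {ρ : W → ClosedTerm L} {x : W} {a : A}
    {q : ClosedTerm L} (h : WSProvable P (.pos (ρ x) a q)) : Ruloid P Λ ρ (.var x) a q where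
  Y := PUnit
  u := .var (.inr ⟨⟩)
  src _ := x
  act _ := a
  τ _ := q
  ws _ := h
  subst_eq := rfl
  sound _ _ _ h := h ⟨⟩
  liquidOnce_inr _ := liquidOnce_var Λ _ _
  occursIn _ h := h
  liquidOnce _ h := h

/-- The property of a closed literal `α` that the induction on well-supported proofs is about: if
the left-hand side of `α` is an instance `t.subst ρ`, then `α` depends only on ready information and
certain transitions of `ρ`. A positive `α` has a `Ruloid`; a negative one is inherited by `ρ'`. -/
def Decomposable (P : TSS L V A) (Λ : ArgPred L) (ρ : W → ClosedTerm L) :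
    Literal L Empty A → Prop
  | .pos p a q => ∀ t : L.Term W, t.subst ρ = p → Nonempty (Ruloid P Λ ρ t a q)
  | .neg p a => ∀ (t : L.Term W) (ρ' : W → ClosedTerm L), ReadyLE P ρ ρ' → t.subst ρ = p →
      WSProvable P (.neg (t.subst ρ') a)

/-- A rule applied to decomposable premises yields a decomposable conclusion: in the target of the
rule, the right-hand side of each premise is replaced by the target of its decomposition. -/
theorem Ruloid.nonempty_of_rule {P : TSS L V A} {Λ : ArgPred L} {ρ : W → ClosedTerm L}
    {r : Rule L V A} (hr : r ∈ P.rules) (hf : r.IsNtyft ∨ r.IsNtyxt) (hsafe : r.ReadyTraceSafe Λ)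
    {s tgt : L.Term V} {a : A} (hc : r.conclusion = .pos s a tgt) {σ : V → ClosedTerm L}
    (h : ∀ β ∈ r.premises, Decomposable P Λ ρ (β.subst σ))
    {n : ℕ} {f : L.Functions n} {ts : Fin n → L.Term W}
    (ht : (FirstOrder.Language.Term.func f ts).subst ρ = s.subst σ) :
    Nonempty (Ruloid P Λ ρ (.func f ts) a (tgt.subst σ)) := by
  classical
  have hsrc : r.source = s := by rw [Rule.source, hc]; rfl
  have htgt : tgt ∈ r.target := by rw [Rule.target, hc]; rfl
  have hnt := Rule.isNtytt_of_format hf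
  obtain ⟨σ₀, hσ₀, hσ, hocc⟩ := Rule.exists_match hf (ρ := ρ) (hsrc.symm ▸ ht.symm)
  have hcomp (p : L.Term V) : (p.subst σ₀).subst ρ = p.subst σ := by
    rw [subst_subst]
    exact congrArg _ (funext hσ)
  choose lhs act hmem using fun i : {y : V // r.PremiseRhs y} => i.2
  have hprem {p c y} (hl : Literal.pos p c (.var y) ∈ r.premises) (hy : r.PremiseRhs y) :
      p = lhs ⟨y, hy⟩ ∧ c = act ⟨y, hy⟩ := by
    have := hnt.rhs_distinct _ hl _ (hmem ⟨y, hy⟩) _ rfl rfl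
    injection this with h₁ h₂ _
    exact ⟨h₁, h₂⟩
  have R (i : {y : V // r.PremiseRhs y}) :
      Nonempty (Ruloid P Λ ρ ((lhs i).subst σ₀) (act i) (σ i.1)) :=
    h _ (hmem i) _ (hcomp _)
  replace R := fun i => (R i).some
  let Y := Σ i, (R i).Y
  let σ₁ : V → L.Term (W ⊕ Y) := fun v =>
    if hv : r.PremiseRhs v then
      (R ⟨v, hv⟩).u.subst fun z => .var (Sum.map id (Sigma.mk ⟨v, hv⟩) z)
    else (σ₀ v).subst fun x => .var (.inl x)
  have σ₁_pos {v} (hv : r.PremiseRhs v) : σ₁ v =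
      (R ⟨v, hv⟩).u.subst fun z => .var (Sum.map id (Sigma.mk ⟨v, hv⟩) z) := dif_pos hv
  have σ₁_neg {v} (hv : ¬ r.PremiseRhs v) : σ₁ v = (σ₀ v).subst fun x => .var (.inl x) :=
    dif_neg hv
  have σ₁_subst_pos (ρ' : W → ClosedTerm L) (τ' : Y → ClosedTerm L) {v} (hv : r.PremiseRhs v) :
      (σ₁ v).subst (Sum.elim ρ' τ') =
        (R ⟨v, hv⟩).u.subst (Sum.elim ρ' fun y => τ' ⟨⟨v, hv⟩, y⟩) := by
    rw [σ₁_pos hv, subst_subst]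
    congr 1
    funext z
    cases z <;> rfl
  have σ₁_subst_neg (ρ' : W → ClosedTerm L) (τ' : Y → ClosedTerm L) {v}
      (hv : ¬ r.PremiseRhs v) :
      (σ₁ v).subst (Sum.elim ρ' τ') = (σ₀ v).subst ρ' := by
    rw [σ₁_neg hv, subst_subst]
    rfl
  let m : W ⊕ Y → W := Sum.elim id fun y => (R y.1).src y.2
  have σ₁_m_pos {v} (hv : r.PremiseRhs v) : ((σ₁ v).subst fun z => .var (m z)) =
      (R ⟨v, hv⟩).u.subst fun z => .var (Sum.elim id (R ⟨v, hv⟩).src z) := by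
    rw [σ₁_pos hv, subst_subst]
    congr 1
    funext z
    cases z <;> rfl
  have σ₁_m_neg {v} (hv : ¬ r.PremiseRhs v) : ((σ₁ v).subst fun z => .var (m z)) = σ₀ v := by
    rw [σ₁_neg hv, subst_subst]
    exact subst_var _
  have hocc' : ∀ p c y, Literal.pos p c (.var y) ∈ r.premises → ∀ x,
      OccursIn x ((σ₁ y).subst fun z => .var (m z)) → OccursIn x (p.subst σ₀) := by
    intro p c y hl x hx
    have hy : r.PremiseRhs y := ⟨p, c, hl⟩
    rw [σ₁_m_pos hy] at hx
    rw [(hprem hl hy).1]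
    exact (R _).occursIn x hx
  -- The left-hand sides of premises and the source contain no right-hand sides of premises.
  have lhs_subst (ρ' : W → ClosedTerm L) (τ' : Y → ClosedTerm L) {p : L.Term V}
      (hp : ∀ v, OccursIn v p → ¬ r.PremiseRhs v) :
      (p.subst fun v => (σ₁ v).subst (Sum.elim ρ' τ')) = (p.subst σ₀).subst ρ' := by
    rw [subst_subst]
    exact subst_congr fun v hv => σ₁_subst_neg ρ' τ' (hp v hv)
  refine ⟨{
    Y := Y
    u := tgt.subst σ₁
    src := fun y => (R y.1).src y.2
    act := fun y => (R y.1).act y.2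
    τ := fun y => (R y.1).τ y.2
    ws := fun y => (R y.1).ws y.2
    subst_eq := ?_
    sound := ?_
    liquidOnce_inr := ?_
    occursIn := ?_
    liquidOnce := ?_ }⟩
  · rw [subst_subst]
    congr 1
    funext v
    by_cases hv : r.PremiseRhs v
    · rw [σ₁_subst_pos _ _ hv, (R ⟨v, hv⟩).subst_eq]
    · rw [σ₁_subst_neg _ _ hv, hσ]
  · intro ρ' τ' hρ hτ
    have key := WSProvable.rule hr (fun v => (σ₁ v).subst (Sum.elim ρ' τ')) fun β hβ => ?_
    · rw [hc] at key
      simp only [Literal.subst] at key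
      rw [lhs_subst ρ' τ' fun v hv hv' => hnt.not_occursIn_source hv' (hsrc.symm ▸ hv), ← hsrc, hσ₀,
        ← subst_subst] at key
      exact key
    · cases β with
      | neg p c =>
        simp only [Literal.subst]
        rw [lhs_subst ρ' τ' (p := p) (hsafe.1.not_premiseRhs hβ)]
        exact h _ hβ _ ρ' hρ (hcomp p)
      | pos p c t' =>
        obtain ⟨y, rfl⟩ := hnt.rhs_var _ hβ t' rfl
        have hy : r.PremiseRhs y := ⟨p, c, hβ⟩
        simp only [Literal.subst]
        rw [lhs_subst ρ' τ' (p := p) (hsafe.1.not_premiseRhs hβ)]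
        change WSProvable P (.pos _ c ((σ₁ y).subst (Sum.elim ρ' τ')))
        rw [σ₁_subst_pos _ _ hy, (hprem hβ hy).1, (hprem hβ hy).2]
        exact (R ⟨y, hy⟩).sound ρ' _ hρ fun z => hτ ⟨⟨y, hy⟩, z⟩
  · rintro ⟨⟨y, hy⟩, z⟩
    -- Only the right-hand side `y` contributes occurrences of the variables indexed by it.
    have only {v} (hv : OccursIn (Sum.inr ⟨⟨y, hy⟩, z⟩) (σ₁ v)) : v = y := by
      by_cases hvy : r.PremiseRhs v
      · rw [σ₁_pos hvy] at hv
        obtain ⟨x' | z', -, ⟨⟨hw⟩⟩⟩ := occursIn_subst.1 hv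
        · cases hw
        · cases hw
          rfl
      · rw [σ₁_neg hvy] at hv
        obtain ⟨x', -, ⟨⟨hw⟩⟩⟩ := occursIn_subst.1 hv
        cases hw
    refine .subst (fun v _ hv' => ?_) fun v w _ hv _ hw => (only hv).trans (only hw).symm
    obtain rfl := only hv'
    refine ⟨⟨fun o o' => ?_, fun o => ?_⟩, ?_⟩
    · cases (hsafe.2 v (.inl ⟨_, hy.choose_spec.choose_spec, rfl⟩)).1 (.inTarget tgt htgt o)
        (.inTarget tgt htgt o')
      rfl
    · exact (hsafe.2 v (.inl ⟨_, hy.choose_spec.choose_spec, rfl⟩)).2 (.inTarget tgt htgt o)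
    · rw [σ₁_pos hy]
      have inj : ∀ w : W ⊕ (R ⟨v, hy⟩).Y, OccursIn (Sum.inr (⟨⟨v, hy⟩, z⟩ : Y))
          (FirstOrder.Language.Term.var (L := L) (Sum.map id (Sigma.mk ⟨v, hy⟩) w)) →
          w = .inr z := by
        rintro (x' | z') ⟨⟨hw⟩⟩ <;> cases hw
        rfl
      refine .subst (fun w _ hw => ?_) fun w w' _ hw _ hw' => (inj w hw).trans (inj w' hw').symm
      obtain rfl := inj w hw
      exact ⟨(R ⟨v, hy⟩).liquidOnce_inr z, liquidOnce_var Λ _ _⟩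
  · intro x hx
    rw [subst_subst] at hx
    obtain ⟨v, -, hv⟩ := occursIn_subst.1 hx
    rw [← hσ₀]
    by_cases hvy : r.PremiseRhs v
    · obtain ⟨p, c, hl⟩ := id hvy
      obtain ⟨w, -, hw⟩ := occursIn_subst.1 (hocc' p c v hl x hv)
      exact occursIn_subst.2 ⟨w, hocc w x hw, hw⟩
    · have hv : OccursIn x ((σ₁ v).subst fun z => .var (m z)) := hv
      rw [σ₁_m_neg hvy] at hv
      exact occursIn_subst.2 ⟨v, hocc v x hv, hv⟩
  · intro x hx
    rw [subst_subst]
    rw [← hσ₀] at hx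
    refine hsafe.liquidOnce_target hf htgt hocc (fun v hv => σ₁_m_neg hv) hocc' ?_ hx
    intro p c y hl x hx
    have hy : r.PremiseRhs y := ⟨p, c, hl⟩
    change LiquidOnce Λ ((σ₁ y).subst fun z => .var (m z)) x
    rw [σ₁_m_pos hy]
    rw [(hprem hl hy).1] at hx
    exact (R _).liquidOnce x hx

/-- If `t.subst ρ'` can be proved to do `a` from negative hypotheses `N'` without a well-supported
refutation, then `t.subst ρ` can be proved to do `a` from the negative literals not refuted by `K`.
The proof from `N'` is followed rule by rule down to the transitions of the terms `ρ' x`; as these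
do not refuse the action in question, neither do the `ρ x`. -/
theorem ClosedProvable.exists_of_readyLE {P : TSS L V A} {Λ : ArgPred L} (hstd : P.IsStandard)
    (hfmt : ∀ r ∈ P.rules, r.IsNtyft ∨ r.IsNtyxt) (hsafe : ∀ r ∈ P.rules, r.ReadyTraceSafe Λ)
    {ρ ρ' : W → ClosedTerm L} (hρ : ReadyLE P ρ ρ') {K : Set (Literal L Empty A)}
    (hK : ∀ κ ∈ K, WSProvable P κ) (hdec : ∀ κ ∈ K, Decomposable P Λ ρ κ)
    {N' : Set (Literal L Empty A)} (hneg : ∀ ν ∈ N', ν.IsNeg)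
    (hN' : ∀ κ, WSProvable P κ → ∀ ν ∈ N', ¬ κ.Denies ν)
    {α : Literal L Empty A} (h : ClosedProvable P N' α) :
    ∀ (t : L.Term W) (a : A) (q' : ClosedTerm L), α = .pos (t.subst ρ') a q' →
      ∃ q, ClosedProvable P {ν | ν.IsNeg ∧ ∀ κ ∈ K, ¬ κ.Denies ν} (.pos (t.subst ρ) a q) := by
  classical
  induction h with
  | hyp h =>
    rintro t a q' rfl
    obtain ⟨_, _, h⟩ := hneg _ h
    cases h
  | @rule r hr σ' h ih =>
    intro t a q' hα
    have hpr := ClosedProvable.rule hr σ' h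
    rw [hα] at hpr
    obtain ⟨s, b, tgt, hc⟩ := hstd r hr
    rw [hc] at hα
    injection hα with h₁ h₂ _
    subst h₂
    cases t with
    | var x =>
      have hx : ¬ WSProvable P (.neg (ρ x) b) := fun hx => by
        -- Then `ρ' x` would refuse `b` too, which the proof from `N'` precludes.
        have hx' := (hρ x b).1 hx
        generalize hl : Literal.neg (ρ' x) b = l at hx'
        cases hx' with
        | rule hr₂ σ₂ _ =>
          obtain ⟨s₂, b₂, t₂, hc₂⟩ := hstd _ hr₂
          rw [hc₂] at hl
          cases hl
        | naf K₂ hK₂ _ hβ =>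
          subst hl
          obtain ⟨κ, hκ, ν, hν, hd⟩ := hβ N' (.pos (ρ' x) b q') hneg ⟨rfl, rfl⟩ hpr.provable
          exact hN' κ (hK₂ κ hκ) ν hν hd
      obtain ⟨N, q, hq, hN, hd⟩ := exists_closedProvable_of_not_wsProvable_neg hx
      have := hq.provable.closed (fun _ => ρ x)
        (N := {ν | ν.IsNeg ∧ ∀ κ ∈ K, ¬ κ.Denies ν}) ?_
      · rw [Literal.ofClosed_subst] at this
        exact ⟨q, this⟩
      · rintro _ ⟨ν, hν, rfl⟩
        rw [Literal.ofClosed_subst]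
        exact ⟨hN ν hν, fun κ hκ => hd κ (hK κ hκ) ν hν⟩
    | func f ts =>
      have hsrc : r.source = s := by rw [Rule.source, hc]; rfl
      have hnt := Rule.isNtytt_of_format (hfmt r hr)
      obtain ⟨σ₀, hσ₀, hσ, hocc⟩ := Rule.exists_match (hfmt r hr) (ρ := ρ') (hsrc.symm ▸ h₁)
      have hcomp (p : L.Term V) : (p.subst σ₀).subst ρ' = p.subst σ' := by
        rw [subst_subst]
        exact congrArg _ (funext hσ)
      have hq (i : {y : V // r.PremiseRhs y}) :
          ∃ q, ∀ p c, Literal.pos p c (.var i.1) ∈ r.premises →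
            ClosedProvable P {ν | ν.IsNeg ∧ ∀ κ ∈ K, ¬ κ.Denies ν}
            (.pos ((p.subst σ₀).subst ρ) c q) := by
        obtain ⟨y, p, c, hl⟩ := i
        obtain ⟨q, hq⟩ := ih _ hl (p.subst σ₀) c (σ' y) (by rw [hcomp]; rfl)
        refine ⟨q, fun p' c' hl' => ?_⟩
        have := hnt.rhs_distinct _ hl' _ hl _ rfl rfl
        injection this with h₁ h₂ _
        rw [h₁, h₂]
        exact hq
      choose q hq using hq
      let σ : V → ClosedTerm L := fun v =>
        if hv : r.PremiseRhs v then q ⟨v, hv⟩ else (σ₀ v).subst ρ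
      have lhs_subst {p : L.Term V} (hp : ∀ v, OccursIn v p → ¬ r.PremiseRhs v) :
          p.subst σ = (p.subst σ₀).subst ρ := by
        rw [subst_subst]
        exact subst_congr fun v hv => dif_neg (hp v hv)
      have key := ClosedProvable.rule (N := {ν | ν.IsNeg ∧ ∀ κ ∈ K, ¬ κ.Denies ν}) hr σ
        fun β hβ => ?_
      · rw [hc] at key
        simp only [Literal.subst] at key
        rw [lhs_subst fun v hv hv' => hnt.not_occursIn_source hv' (hsrc.symm ▸ hv), ← hsrc,
          hσ₀] at key
        exact ⟨_, key⟩
      · cases β with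
        | neg p c =>
          simp only [Literal.subst]
          rw [lhs_subst (p := p) ((hsafe r hr).1.not_premiseRhs hβ)]
          refine .hyp ⟨⟨_, _, rfl⟩, fun κ hκ hd => ?_⟩
          cases κ with
          | neg => exact hd
          | pos p₂ c₂ q₂ =>
            obtain ⟨rfl, rfl⟩ := hd
            -- A refutation of the premise for `ρ` would yield one of its counterpart for `ρ'`.
            obtain ⟨R⟩ := hdec _ hκ _ rfl
            obtain ⟨q₃, hq₃⟩ := R.exists_wsProvable hρ
            rw [hcomp] at hq₃
            exact hN' _ hq₃ _ (ClosedProvable.neg_mem hstd (h _ hβ)) ⟨rfl, rfl⟩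
        | pos p c t' =>
          obtain ⟨y, rfl⟩ := hnt.rhs_var _ hβ t' rfl
          have hy : r.PremiseRhs y := ⟨p, c, hβ⟩
          have hσy : σ y = q ⟨y, hy⟩ := dif_pos hy
          simp only [Literal.subst]
          rw [lhs_subst (p := p) ((hsafe r hr).1.not_premiseRhs hβ)]
          change ClosedProvable P _ (.pos _ c (σ y))
          rw [hσy]
          exact hq ⟨y, hy⟩ p c hβ

/-- Transitions of `t.subst ρ` decompose, and refusals of `t.subst ρ` depend only on the ready
information of `ρ`. Both are shown simultaneously, by induction on well-supported proofs. -/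
theorem WSProvable.decomposable {P : TSS L V A} {Λ : ArgPred L} (hstd : P.IsStandard)
    (hfmt : ∀ r ∈ P.rules, r.IsNtyft ∨ r.IsNtyxt) (hsafe : ∀ r ∈ P.rules, r.ReadyTraceSafe Λ)
    (ρ : W → ClosedTerm L) {α : Literal L Empty A} (h : WSProvable P α) :
    Decomposable P Λ ρ α := by
  induction h with
  | @rule r hr σ h ih =>
    obtain ⟨s, a, tgt, hc⟩ := hstd r hr
    have hws := WSProvable.rule hr σ h
    rw [hc] at hws ⊢
    intro t ht
    cases t with
    | var x =>
      rw [Literal.subst, ← ht] at hws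
      exact ⟨.ofVar Λ hws⟩
    | func f ts => exact Ruloid.nonempty_of_rule hr (hfmt r hr) (hsafe r hr) hc ih ht
  | @naf β K hK hβ h ih =>
    obtain ⟨p, a, rfl⟩ := hβ
    rintro t ρ' hρ rfl
    by_contra hcon
    obtain ⟨N', q', hq', hneg, hN'⟩ :=
      exists_closedProvable_of_not_wsProvable_neg hcon
    obtain ⟨q, hq⟩ :=
      hq'.exists_of_readyLE hstd hfmt hsafe hρ hK ih hneg hN' t a q' rfl
    obtain ⟨κ, hκ, ν, hν, hd⟩ :=
      h _ (.pos (t.subst ρ) a q) (fun ν hν => hν.1) ⟨rfl, rfl⟩ hq.provable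
    exact hν.2 κ hκ hd

end

/-! ### Modal decomposition of ready trace observations -/

/-- The ready trace observation `⋀ ã ∧ ⋀ b⊤ ∧ φ` whose actions `a` and `b` are all those that `p`
refuses and that it can do, respectively. -/
def readyObs (P : TSS L V A) (p : ClosedTerm L) (φ : Obs A) : Obs A :=
  (Obs.conj {a // WSProvable P (.neg p a)} fun i => .cannot i.1).and
    ((Obs.conj {a // ∃ q, WSProvable P (.pos p a q)} fun j => .act j.1 .top).and φ)

theorem isReadyTrace_readyObs (P : TSS L V A) (p : ClosedTerm L) {φ : Obs A}
    (h : φ.IsReadyTrace) : (readyObs P p φ).IsReadyTrace :=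
  .ready _ _ _ _ h

theorem sat_and {P : TSS L V A} {p : ClosedTerm L} {φ ψ : Obs A} :
    Sat P p (φ.and ψ) ↔ Sat P p φ ∧ Sat P p ψ := by
  simp only [Obs.and, Sat]
  refine ⟨fun h => ⟨h ⟨true⟩, h ⟨false⟩⟩, ?_⟩
  rintro h ⟨_ | _⟩
  exacts [h.2, h.1]

theorem sat_readyObs {P : TSS L V A} {p p' : ClosedTerm L} {φ : Obs A} :
    Sat P p' (readyObs P p φ) ↔ (∀ a, WSProvable P (.neg p a) → WSProvable P (.neg p' a)) ∧
      (∀ a, (∃ q, WSProvable P (.pos p a q)) → ∃ q, WSProvable P (.pos p' a q)) ∧ Sat P p' φ := by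
  simp only [readyObs, sat_and, Sat, Subtype.forall, and_true]

/-- Ready trace observations of the instances of a term decompose into ready trace observations of
the closed terms substituted for its variables. A set of observations, read as their
conjunction, is attached to each variable; a single one suffices for the variables with a single,
liquid occurrence. -/
theorem exists_decomposition {P : TSS L V A} {Λ : ArgPred L} (hstd : P.IsStandard)
    (hfmt : ∀ r ∈ P.rules, r.IsNtyft ∨ r.IsNtyxt) (hsafe : ∀ r ∈ P.rules, r.ReadyTraceSafe Λ)
    {φ : Obs A} (hφ : φ.IsReadyTrace) :
    ∀ {W : Type uV} (t : L.Term W) (ρ : W → ClosedTerm L), Sat P (t.subst ρ) φ →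
      ∃ Ψ : W → Set (Obs A), (∀ x, (Ψ x).Nonempty) ∧
        (∀ x, ∀ χ ∈ Ψ x, χ.IsReadyTrace ∧ Sat P (ρ x) χ) ∧
        (∀ x, LiquidOnce Λ t x → (Ψ x).Subsingleton) ∧
        ∀ ρ', (∀ x, OccursIn x t → ∀ χ ∈ Ψ x, Sat P (ρ' x) χ) → Sat P (t.subst ρ') φ := by
  classical
  -- Only the variables that occur in `t` matter, so `ρ'` may be taken to agree with `ρ` elsewhere.
  have total {W : Type uV} (t : L.Term W) (ρ : W → ClosedTerm L) (Ψ : W → Set (Obs A))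
      (φ : Obs A) (hρ : ∀ x, ∀ χ ∈ Ψ x, χ.IsReadyTrace ∧ Sat P (ρ x) χ)
      (h : ∀ ρ', (∀ x, ∀ χ ∈ Ψ x, Sat P (ρ' x) χ) → Sat P (t.subst ρ') φ)
      (ρ' : W → ClosedTerm L) (hρ' : ∀ x, OccursIn x t → ∀ χ ∈ Ψ x, Sat P (ρ' x) χ) :
      Sat P (t.subst ρ') φ := by
    rw [subst_congr (τ := fun x => if OccursIn x t then ρ' x else ρ x)
      fun x hx => (if_pos hx).symm]
    refine h _ fun x χ hχ => ?_
    split_ifs with hx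
    · exact hρ' x hx χ hχ
    · exact (hρ x χ hχ).2
  have dec {W : Type uV} (ρ : W → ClosedTerm L) {α : Literal L Empty A} (h : WSProvable P α) :
      Decomposable P Λ ρ α := h.decomposable hstd hfmt hsafe ρ
  induction hφ with
  | top =>
    intro W t ρ _
    refine ⟨fun _ => {.top}, fun _ => Set.singleton_nonempty _, ?_,
      fun _ _ => Set.subsingleton_singleton, fun _ _ => by trivial⟩
    rintro x _ rfl
    exact ⟨.top, by trivial⟩
  | @ready I J a b φ hφ ih =>
    intro W t ρ h
    simp only [sat_and, Sat] at h
    obtain ⟨hI, hJ, h⟩ := h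
    obtain ⟨Ψ, hne, hΨ, hsub, hdec⟩ := ih t ρ h
    have hΨ' : ∀ x, ∀ χ ∈ readyObs P (ρ x) '' Ψ x, χ.IsReadyTrace ∧ Sat P (ρ x) χ := by
      rintro x _ ⟨χ, hχ, rfl⟩
      exact ⟨isReadyTrace_readyObs P _ (hΨ x χ hχ).1,
        sat_readyObs.2 ⟨fun _ => id, fun _ => id, (hΨ x χ hχ).2⟩⟩
    refine ⟨fun x => readyObs P (ρ x) '' Ψ x, fun x => (hne x).image _, hΨ',
      fun x hx => (hsub x hx).image _, total t ρ _ _ hΨ' fun ρ' hρ' => ?_⟩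
    have hρ'' (x) {χ} (hχ : χ ∈ Ψ x) := sat_readyObs.1 (hρ' x _ ⟨χ, hχ, rfl⟩)
    have hle : ReadyLE P ρ ρ' := fun x a =>
      ⟨(hρ'' x (hne x).some_mem).1 a, (hρ'' x (hne x).some_mem).2.1 a⟩
    simp only [sat_and, Sat]
    refine ⟨fun i => dec ρ (hI i) t ρ' hle rfl, fun j => ?_,
      hdec ρ' fun x _ χ hχ => (hρ'' x hχ).2.2⟩
    obtain ⟨q, hq, -⟩ := hJ j
    obtain ⟨R⟩ := dec ρ hq t rfl
    obtain ⟨q', hq'⟩ := R.exists_wsProvable hle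
    exact ⟨q', hq', trivial⟩
  | @act a φ hφ ih =>
    intro W t ρ h
    obtain ⟨q, hq, h⟩ := h
    obtain ⟨R⟩ := dec ρ hq t rfl
    rw [← R.subst_eq] at h
    obtain ⟨Ψ, hne, hΨ, hsub, hdec⟩ := ih R.u (Sum.elim ρ R.τ) h
    -- What an observation of the closed term put for the variable `z` of the target says about the
    -- closed term that this one equals or is reached from.
    let pre : W ⊕ R.Y → Obs A → Obs A := Sum.elim (fun _ => id) fun y => .act (R.act y)
    let m : W ⊕ R.Y → W := Sum.elim id R.src
    let G : W → Set (Obs A) := fun x =>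
      {g | ∃ z, OccursIn z R.u ∧ m z = x ∧ ∃ χ ∈ Ψ z, g = pre z χ}
    -- Variables without a descendant in the target get a trivial observation, so that the ready
    -- information of every variable is recorded.
    let G' : W → Set (Obs A) := fun x => {g | g ∈ G x ∨ G x = ∅ ∧ g = .top}
    have hG : ∀ x, ∀ g ∈ G x, g.IsReadyTrace ∧ Sat P (ρ x) g := by
      rintro _ _ ⟨x | y, -, rfl, χ, hχ, rfl⟩
      · exact hΨ _ _ hχ
      · exact ⟨.act _ (hΨ _ χ hχ).1, R.τ y, R.ws y, (hΨ _ χ hχ).2⟩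
    have hGsub : ∀ x, LiquidOnce Λ t x → (G x).Subsingleton := by
      rintro x hx _ ⟨z, hz, rfl, χ, hχ, rfl⟩ _ ⟨z', hz', hm, χ', hχ', rfl⟩
      obtain ⟨honce, huniq⟩ := LiquidOnce.of_rename (R.liquidOnce _ hx)
      obtain rfl := huniq z' hz hz' hm
      rw [hsub _ honce hχ hχ']
    have hG'ne : ∀ x, (G' x).Nonempty := fun x =>
      (G x).eq_empty_or_nonempty.elim (fun h => ⟨.top, .inr ⟨h, rfl⟩⟩) fun ⟨g, hg⟩ => ⟨g, .inl hg⟩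
    have hG'sub : ∀ x, LiquidOnce Λ t x → (G' x).Subsingleton := by
      rintro x hx g (hg | ⟨he, rfl⟩) g' (hg' | ⟨he', rfl⟩)
      · exact hGsub x hx hg hg'
      · simp [he'] at hg
      · simp [he] at hg'
      · rfl
    have hΨ' : ∀ x, ∀ χ ∈ readyObs P (ρ x) '' G' x, χ.IsReadyTrace ∧ Sat P (ρ x) χ := by
      rintro x _ ⟨g, hg, rfl⟩
      have : g.IsReadyTrace ∧ Sat P (ρ x) g := by
        obtain hg | ⟨-, rfl⟩ := hg
        · exact hG x g hg
        · exact ⟨.top, by trivial⟩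
      exact ⟨isReadyTrace_readyObs P _ this.1,
        sat_readyObs.2 ⟨fun _ => id, fun _ => id, this.2⟩⟩
    refine ⟨fun x => readyObs P (ρ x) '' G' x, fun x => (hG'ne x).image _, hΨ',
      fun x hx => (hG'sub x hx).image _, total t ρ _ _ hΨ' fun ρ' hρ' => ?_⟩
    have hρ'' (x) {g} (hg : g ∈ G' x) := sat_readyObs.1 (hρ' x _ ⟨g, hg, rfl⟩)
    have hle : ReadyLE P ρ ρ' := fun x a =>
      ⟨(hρ'' x (hG'ne x).some_mem).1 a, (hρ'' x (hG'ne x).some_mem).2.1 a⟩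
    have hpre (z) (hz : OccursIn z R.u) {χ} (hχ : χ ∈ Ψ z) : Sat P (ρ' (m z)) (pre z χ) :=
      (hρ'' (m z) (.inl ⟨z, hz, rfl, χ, hχ, rfl⟩)).2.2
    have hτ (y : R.Y) : ∃ q', WSProvable P (.pos (ρ' (R.src y)) (R.act y) q') ∧
        (OccursIn (.inr y) R.u → ∀ χ ∈ Ψ (.inr y), Sat P q' χ) := by
      by_cases hy : OccursIn (.inr y) R.u
      · obtain ⟨q', hq', hs⟩ := hpre _ hy (hne _).some_mem
        -- All members of `Ψ (inr y)` are satisfied by the same `q'`, as there is only one.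
        refine ⟨q', hq', fun _ χ hχ => ?_⟩
        rwa [hsub _ (R.liquidOnce_inr y) hχ (hne _).some_mem]
      · obtain ⟨q', hq'⟩ := (hle _ _).2 ⟨_, R.ws y⟩
        exact ⟨q', hq', fun h => (hy h).elim⟩
    choose τ' hτ' hsat using hτ
    refine ⟨_, R.sound ρ' τ' hle hτ', hdec _ ?_⟩
    rintro (x | y) hz χ hχ
    · exact hpre _ hz hχ
    · exact hsat y hz χ hχ

end SOS

theorem mainTheorem1 {L : FirstOrder.Language} {V A : Type*} [Infinite V]
    (hA : Nonempty (A ↪ V)) (hL : Nonempty ((Σ n : ℕ, L.Functions n) ↪ V))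
    (P : SOS.TSS L V A) (hstd : P.IsStandard) (hfmt : P.InReadyTraceFormat) :
    SOS.IsPrecongruence (SOS.ReadyTraceLE P) := by
  refine ⟨fun p => subset_rfl, fun p q r => Set.Subset.trans, fun n f p q hpq φ ⟨hφ, hsat⟩ => ?_⟩
  obtain ⟨hf, Λ, hsafe⟩ := hfmt
  -- The open term `f(x₁, …, xₙ)`, over a type of variables in the universe of `V`.
  let t : L.Term (ULift (Fin n)) := .func f fun i => .var ⟨i⟩
  obtain ⟨Ψ, -, hΨ, -, hdec⟩ :=
    SOS.exists_decomposition hstd hf hsafe hφ t (fun i => p i.down) hsat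
  exact ⟨hφ, hdec (fun i => q i.down) fun i _ χ hχ => (hpq i.down (hΨ i χ hχ)).2⟩
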